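/- Let $M$ be a Hausdorff, second countable topological manifold without boundary, of dimension $n\ge 0$, with its Borel $\sigma$-algebra, and let $T$ be a standard Borel space with a $\sigma$-finite measure $\Lambda$. Let the product lamination $M\times T$ carry the product $\sigma$-algebra and the product of the topology of $M$ with the discrete topology of $T$ (topological terms below refer to this topology). Let $\widetilde\Lambda$ be the Borel measure on $M\times T$ that extends the transverse invariant measure given by $\Lambda$ and pairs $\Lambda$ with the counting measures of the plaques, $$\widetilde\Lambda(B)=\int_T \#\bigl(B\cap (M\times\{t\})\bigr)\,d\Lambda(t)\qquad (B\subset M\times T\text{ measurable}).$$ A deformation of a measurable open set $U\subset M\times T$ is a measurable continuous map $H:U\times\mathbb R\to M\times T$ with $H(x,0)=x$ for all $x\in U$. Put $$\tau_\Lambda(U)=\inf_H\widetilde\Lambda\bigl(H(U\times\{1\})\bigr),\qquad \operatorname{Cat}(M\times T,\Lambda)=\inf_{\mathcal U}\sum_{U\in\mathcal U}\tau_\Lambda(U),$$ where $H$ runs over the deformations of $U$ and $\mathcal U$ over the countable coverings of $M\times T$ by measurable open sets. Let $\operatorname{Cat}(M)\in\mathbb N\cup\{\infty\}$ be the Lusternik–Schnirelmann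 category of $M$, the minimum number of open subsets of $M$, each contractible to a point within $M$, that are needed to cover $M$. Then, with the convention $0\cdot\infty=0$, $$\operatorname{Cat}(M\times T,\Lambda)=\operatorname{Cat}(M)\cdot\Lambda(T).$$ -/

import Mathlib

open Set MeasureTheory Topology
open scoped ENNReal

/-! ### Notions for measurable topological spaces

A measurable topological space is a type with a topology and a σ-algebra that need not be related.
Its leaves are its connected components. -/

section MTSpace

variable {X : Type*} [TopologicalSpace X] [MeasurableSpace X]

/-- A transversal: a measurable set whose intersection with each leaf is countable. -/
def IsTransversal (S : Set X) : Prop :=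
  MeasurableSet S ∧ ∀ x : X, (S ∩ connectedComponent x).Countable

/-- A measurable (tangential) deformation of `U`: a measurable continuous map `H : U × ℝ → X` such
that `H(·, 0)` is the inclusion. By continuity it maps leaves into leaves. -/
structure IsDeformation (U : Set X) (H : U × ℝ → X) : Prop where
  continuous : Continuous H
  measurable : Measurable H
  map_zero : ∀ x : U, H (x, 0) = x

/-- `τ_Λ(U)`, the infimum of `ν(H(U × {1}))` over the deformations `H` of `U`, where `ν` is the
coherent extension of the transverse invariant measure `Λ`. -/
noncomputable def tau (ν : Measure X) (U : Set X) : ℝ≥0∞ :=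
  ⨅ (H : U × ℝ → X) (_ : IsDeformation U H), ν (range fun x : U => H (x, 1))

/-- The `Λ`-category: the infimum of `∑ τ_Λ(U)` over the countable coverings `𝒰` of `X` by
measurable open sets, where `ν` is the coherent extension of `Λ`. -/
noncomputable def lambdaCat (ν : Measure X) : ℝ≥0∞ :=
  ⨅ (𝒰 : Set (Set X)) (_ : 𝒰.Countable)
    (_ : ∀ U ∈ 𝒰, IsOpen U ∧ MeasurableSet U) (_ : ⋃₀ 𝒰 = univ), ∑' U : 𝒰, tau ν U.1

end MTSpace

/-- The (classical) Lusternik-Schnirelmann category of a space: the minimum number of open sets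
contractible within `M` that are needed to cover `M` (`⊤` if no finite number is enough). -/
noncomputable def lsCat (M : Type*) [TopologicalSpace M] : ℕ∞ :=
  ⨅ (𝒰 : Set (Set M))
    (_ : ∀ U ∈ 𝒰, IsOpen U ∧
      (ContinuousMap.mk (Subtype.val : U → M) continuous_subtype_val).Nullhomotopic)
    (_ : ⋃₀ 𝒰 = univ), 𝒰.encard

/-! ### Analytic sets are null-measurable -/

theorem exists_compact_approx {Y : Type*} [TopologicalSpace Y] [PolishSpace Y]
    [MeasurableSpace Y] [BorelSpace Y] (μ : Measure Y) [IsFiniteMeasure μ]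
    {f : (ℕ → ℕ) → Y} (hf : Continuous f) {ε : ℝ≥0∞} (hε : ε ≠ 0) :
    ∃ K : Set Y, IsCompact K ∧ K ⊆ range f ∧ μ (range f) ≤ μ K + ε := by
  obtain ⟨δ, δpos, hδ⟩ := ENNReal.exists_pos_sum_of_countable' hε ℕ
  have step : ∀ (C : Set (ℕ → ℕ)) (k : ℕ),
      ∃ n : ℕ, μ (f '' C) ≤ μ (f '' (C ∩ {x | x k ≤ n})) + δ k := by
    intro C k
    have hmono : Monotone fun n : ℕ => f '' (C ∩ {x | x k ≤ n}) := fun a b hab =>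
      image_mono (inter_subset_inter_right _ fun x (hx : x k ≤ a) => le_trans hx hab)
    have hU : f '' C = ⋃ n : ℕ, f '' (C ∩ {x | x k ≤ n}) := by
      rw [← image_iUnion, ← inter_iUnion]
      congr 1
      ext x
      simp only [mem_inter_iff, mem_iUnion, mem_ofPred_eq]
      exact ⟨fun h => ⟨h, x k, le_rfl⟩, fun h => h.1⟩
    by_contra! hcon
    have h1 : ∀ n : ℕ, μ (f '' (C ∩ {x | x k ≤ n})) ≤ μ (f '' C) - δ k := fun n =>
      ENNReal.le_sub_of_add_le_right (ne_top_of_lt (hcon n) |> fun h => ne_top_of_le_ne_top h le_add_self) (hcon n).le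
    have h2 : μ (f '' C) ≤ μ (f '' C) - δ k := by
      conv_lhs => rw [hU, hmono.measure_iUnion]
      exact iSup_le h1
    have h3 : μ (f '' C) ≠ 0 := (ne_bot_of_gt (hcon 0))
    exact absurd h2 (not_le.2 (ENNReal.sub_lt_self (measure_ne_top _ _) h3 (δpos k).ne'))
  choose N hN using step
  let C : ℕ → Set (ℕ → ℕ) := fun k => Nat.rec univ (fun k C => C ∩ {x | x k ≤ N C k}) k
  have hC0 : C 0 = univ := rfl
  have hCs : ∀ k, C (k + 1) = C k ∩ {x | x k ≤ N (C k) k} := fun k => rfl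
  let n : ℕ → ℕ := fun k => N (C k) k
  have hC : ∀ k, C k = {x | ∀ i < k, x i ≤ n i} := by
    intro k
    induction k with
    | zero => simp [hC0]
    | succ k ih =>
      rw [hCs]
      conv_lhs => rw [ih]
      ext x
      simp only [mem_inter_iff, mem_ofPred_eq, Nat.lt_succ_iff_lt_or_eq]
      constructor
      · rintro ⟨h, h'⟩ i (hi | rfl)
        · exact h i hi
        · simpa [n, ih] using h'
      · intro h
        exact ⟨fun i hi => h i (Or.inl hi), by simpa [n, ih] using h k (Or.inr rfl)⟩
  have hμC : ∀ k, μ (range f) ≤ μ (f '' C k) + ∑ i ∈ Finset.range k, δ i := by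
    intro k
    induction k with
    | zero => simp [hC0]
    | succ k ih =>
      rw [Finset.sum_range_succ, hCs]
      calc μ (range f) ≤ _ := ih
        _ ≤ _ := add_le_add_left (hN (C k) k) _
        _ = _ := by ring
  let K : Set (ℕ → ℕ) := univ.pi fun i => Iic (n i)
  have hK : IsCompact K := isCompact_univ_pi fun i => (finite_Iic (n i)).isCompact
  refine ⟨f '' K, hK.image hf, image_subset_range _ _, ?_⟩
  refine ENNReal.le_of_forall_pos_le_add ?_
  intro η hη _
  obtain ⟨V, hKV, hVo, hV⟩ := (f '' K).exists_isOpen_lt_add (μ := μ) (measure_ne_top _ _)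
    (ENNReal.coe_pos.2 hη).ne'
  have hO : IsOpen (f ⁻¹' V) := hVo.preimage hf
  have hx : ∀ x ∈ K, ∃ k, PiNat.cylinder x k ⊆ f ⁻¹' V := by
    intro x hx
    obtain ⟨s, ⟨y, k, rfl⟩, hxs, hs⟩ :=
      (PiNat.isTopologicalBasis_cylinders (fun _ : ℕ => ℕ)).exists_subset_of_mem_open
        (hKV (mem_image_of_mem f hx)) hO
    exact ⟨k, by rwa [PiNat.mem_cylinder_iff_eq.1 hxs]⟩
  choose! κ hκ using hx
  obtain ⟨t, htK, ht⟩ := hK.elim_nhds_subcover (fun x => PiNat.cylinder x (κ x))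
    fun x _ => (PiNat.isOpen_cylinder _ x _).mem_nhds (PiNat.self_mem_cylinder x _)
  have hsub : f '' C (t.sup κ) ⊆ V := by
    rw [image_subset_iff]
    intro y hy
    rw [hC] at hy
    have hy' : (fun i => min (y i) (n i)) ∈ K := fun i _ => mem_Iic.2 (min_le_right _ _)
    obtain ⟨x, hxt, hyx⟩ := mem_iUnion₂.1 (ht hy')
    apply hκ x (htK x hxt)
    intro i hi
    rw [← hyx i hi]
    exact (min_eq_left (hy i (lt_of_lt_of_le hi (Finset.le_sup hxt)))).symm
  calc μ (range f) ≤ _ := hμC (t.sup κ)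
    _ ≤ μ V + ε := add_le_add (measure_mono hsub) ((ENNReal.sum_le_tsum _).trans hδ.le)
    _ ≤ μ (f '' K) + η + ε := by gcongr
    _ = _ := by ring

theorem nullMeasurableSet_of_analyticSet {Y : Type*} [TopologicalSpace Y] [PolishSpace Y]
    [MeasurableSpace Y] [BorelSpace Y] (μ : Measure Y) [SigmaFinite μ]
    {A : Set Y} (hA : AnalyticSet A) : NullMeasurableSet A μ := by
  obtain ⟨ν, hν, hμν, -⟩ := exists_isFiniteMeasure_absolutelyContinuous μ
  refine NullMeasurableSet.mono_ac ?_ hμν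
  rw [AnalyticSet] at hA
  obtain rfl | ⟨f, hf, rfl⟩ := hA
  · exact nullMeasurableSet_empty
  choose K hKc hKs hK using fun m : ℕ =>
    exists_compact_approx ν hf (ε := (m : ℝ≥0∞)⁻¹) (by simp)
  have hm : MeasurableSet (⋃ m, K m) := .iUnion fun m => (hKc m).measurableSet
  have hs : (⋃ m, K m) ⊆ range f := iUnion_subset hKs
  have hle : ν (range f) ≤ ν (⋃ m, K m) := by
    have h : ∀ m : ℕ, ν (range f) ≤ ν (⋃ m, K m) + (m : ℝ≥0∞)⁻¹ := fun m =>
      (hK m).trans (add_le_add_left (measure_mono (subset_iUnion K m)) _)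
    have := ge_of_tendsto' (tendsto_const_nhds.add ENNReal.tendsto_inv_nat_nhds_zero) h
    simpa using this
  exact ⟨_, hm, (ae_eq_of_subset_of_measure_ge hs hle hm.nullMeasurableSet
    (measure_ne_top _ _)).symm⟩

/-! ### Products `M × T`

For a topological space `M` with its Borel σ-algebra and a standard Borel space `T`, the product
lamination is `M × T` with the product σ-algebra and with the product of the topology of `M` and
the discrete topology of `T`. Accordingly `T` carries the discrete topology below, whenever the
topology of `M × T` matters. -/

namespace ProductLamination

variable {M T : Type*}

/-- The part of `B ⊆ M × T` in the plaque `M × {t}`, as a subset of `M`. -/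
def slice (B : Set (M × T)) (t : T) : Set M := {x | (x, t) ∈ B}

theorem encard_eq_iSup [TopologicalSpace M] [PolishSpace M] (C : Set M) :
    (C.encard : ℝ≥0∞) =
      ⨆ (F : Finset (TopologicalSpace.countableBasis M))
        (_ : (F : Set (TopologicalSpace.countableBasis M)).Pairwise
          fun V W => Disjoint (V : Set M) (W : Set M)),
        ∑ V ∈ F, {c : Set M | (V.1 ∩ c).Nonempty}.indicator (fun _ => (1 : ℝ≥0∞)) C := by
  classical
  apply le_antisymm
  · refine ENNReal.le_of_forall_nnreal_lt fun r hr => ?_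
    obtain ⟨k, hk, hkC⟩ : ∃ k : ℕ, (r : ℝ≥0∞) ≤ k ∧ (k : ℕ∞) ≤ C.encard := by
      obtain h | h := eq_or_ne C.encard ⊤
      · obtain ⟨k, hk⟩ := exists_nat_ge r
        exact ⟨k, by exact_mod_cast hk, by simp [h]⟩
      · obtain ⟨k, hk⟩ := ENat.ne_top_iff_exists.1 h
        refine ⟨k, ?_, hk.le⟩
        rw [← hk] at hr
        simpa using hr.le
    refine hk.trans ?_
    obtain ⟨S, hSC, hS⟩ := exists_subset_encard_eq hkC
    have hSf : S.Finite := finite_of_encard_eq_coe hS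
    obtain ⟨U, hU, hdis⟩ := hSf.t2_separation
    have : ∀ x : M, ∃ V : TopologicalSpace.countableBasis M, x ∈ V.1 ∧ V.1 ⊆ U x := by
      intro x
      obtain ⟨V, hV, hx, hVU⟩ := (TopologicalSpace.isBasis_countableBasis M).exists_subset_of_mem_open
        (hU x).1 (hU x).2
      exact ⟨⟨V, hV⟩, hx, hVU⟩
    choose V hxV hVU using this
    have hinj : InjOn V S := by
      intro x hx y hy hxy
      by_contra hne
      exact disjoint_left.1 (hdis hx hy hne) (hVU x (hxV x)) (hVU y (hxy ▸ hxV x))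
    have hcard : (hSf.toFinset.image V).card = k := by
      rw [Finset.card_image_of_injOn (by simpa using hinj)]
      rw [hSf.encard_eq_coe_toFinset_card] at hS
      exact_mod_cast hS
    refine le_iSup₂_of_le (hSf.toFinset.image V) ?_ ?_
    · intro v hv w hw hvw
      simp only [Finset.coe_image, Finite.coe_toFinset] at hv hw
      obtain ⟨x, hx, rfl⟩ := hv
      obtain ⟨y, hy, rfl⟩ := hw
      exact (hdis hx hy fun h => hvw (h ▸ rfl)).mono (hVU x) (hVU y)
    · rw [Finset.sum_congr rfl (g := fun _ => (1 : ℝ≥0∞))]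
      · simp [hcard]
      · intro v hv
        obtain ⟨x, hx, rfl⟩ := Finset.mem_image.1 hv
        exact indicator_of_mem (s := {c : Set M | ((V x).1 ∩ c).Nonempty})
          (show ((V x).1 ∩ C).Nonempty from ⟨x, hxV x, hSC (by simpa using hx)⟩)
          (fun _ => (1 : ℝ≥0∞))
  · refine iSup₂_le fun F hF => ?_
    have h1 : ∑ V ∈ F, {c : Set M | (V.1 ∩ c).Nonempty}.indicator (fun _ => (1 : ℝ≥0∞)) C
        = ((F.filter fun V => (V.1 ∩ C).Nonempty).card : ℕ∞) := by
      simp [indicator_apply]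
    rw [h1, ENat.toENNReal_le, ← encard_coe_eq_coe_finsetCard]
    obtain hM | hM := isEmpty_or_nonempty M
    · have hemp : (F.filter fun V => (V.1 ∩ C).Nonempty) = ∅ :=
        Finset.filter_eq_empty_iff.2 fun V _ h => hM.false h.some
      simp [hemp]
    have h2 : ∀ V : TopologicalSpace.countableBasis M, (V.1 ∩ C).Nonempty → ∃ x, x ∈ V.1 ∧ x ∈ C :=
      fun V h => h
    choose! p hp using h2
    refine encard_le_encard_of_injOn (f := p) ?_ ?_
    · intro V hV
      exact (hp V (by simpa using (Finset.mem_filter.1 hV).2)).2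
    · intro V hV W hW hVW
      by_contra hne
      have hV' := Finset.mem_filter.1 hV
      have hW' := Finset.mem_filter.1 hW
      exact disjoint_left.1 (hF hV'.1 hW'.1 hne) (hp V hV'.2).1 (hVW ▸ (hp W hW'.2).1)

variable [TopologicalSpace M] [PolishSpace M] [MeasurableSpace M] [BorelSpace M]
  [MeasurableSpace T] [StandardBorelSpace T]

theorem aemeasurable_encard_slice (Λ : Measure T) [SigmaFinite Λ]
    {B : Set (M × T)} (hB : MeasurableSet B) :
    AEMeasurable (fun t => ((slice B t).encard : ℝ≥0∞)) Λ := by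
  let _ := upgradeStandardBorel T
  simp_rw [encard_eq_iSup]
  have : Countable (TopologicalSpace.countableBasis M) :=
    (TopologicalSpace.countable_countableBasis M).to_subtype
  refine .iSup fun F => .iSup fun _ => Finset.aemeasurable_fun_sum _ fun V _ => ?_
  have hV : MeasurableSet ((Prod.fst ⁻¹' V.1 ∩ B : Set (M × T))) :=
    (measurable_fst (TopologicalSpace.isOpen_of_mem_countableBasis V.2).measurableSet).inter hB
  have hA : NullMeasurableSet (Prod.snd '' (Prod.fst ⁻¹' V.1 ∩ B : Set (M × T))) Λ :=
    nullMeasurableSet_of_analyticSet Λ (hV.analyticSet_image measurable_snd)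
  refine ((aemeasurable_const (b := (1 : ℝ≥0∞))).indicator₀ hA).congr (.of_forall fun t => ?_)
  have hiff : t ∈ Prod.snd '' (Prod.fst ⁻¹' V.1 ∩ B : Set (M × T)) ↔
      slice B t ∈ {c : Set M | (V.1 ∩ c).Nonempty} :=
    ⟨fun ⟨⟨x, s⟩, ⟨h1, h2⟩, h3⟩ => by subst h3; exact ⟨x, h1, h2⟩,
      fun ⟨x, h1, h2⟩ => ⟨(x, t), ⟨h1, h2⟩, rfl⟩⟩
  by_cases h : t ∈ Prod.snd '' (Prod.fst ⁻¹' V.1 ∩ B : Set (M × T))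
  · simp only [indicator_of_mem h]
    rw [indicator_of_mem (hiff.1 h)]
  · simp only [indicator_of_notMem h]
    rw [indicator_of_notMem (fun h' => h (hiff.2 h'))]

theorem encard_iUnion_eq_tsum {α : Type*} {f : ℕ → Set α} (h : Pairwise (Function.onFun Disjoint f)) :
    ((⋃ i, f i).encard : ℝ≥0∞) = ∑' i, ((f i).encard : ℝ≥0∞) := by
  let _ : MeasurableSpace α := ⊤
  have := measure_iUnion (μ := Measure.count) h fun i => (MeasurableSpace.measurableSet_top)
  simpa only [Measure.count_apply MeasurableSpace.measurableSet_top] using this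

/-- The coherent extension to `M × T` of the transverse invariant measure given by `Λ`:
the Borel measure `B ↦ ∫ #(B ∩ (M × {t})) dΛ(t)`, which pairs `Λ` with the counting measures of the
plaques. Its restriction to transversals is the transverse invariant measure itself. -/
noncomputable def coherentExtension (M : Type*) [TopologicalSpace M] [PolishSpace M]
    [MeasurableSpace M] [BorelSpace M] {T : Type*} [MeasurableSpace T] [StandardBorelSpace T]
    (Λ : Measure T) [SigmaFinite Λ] : Measure (M × T) :=
  Measure.ofMeasurable (fun B _ => ∫⁻ t, ((slice B t).encard : ℝ≥0∞) ∂Λ)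
    (by simp [slice])
    (by
      intro f hf hd
      rw [← lintegral_tsum fun i => aemeasurable_encard_slice Λ (hf i)]
      refine lintegral_congr fun t => ?_
      rw [← encard_iUnion_eq_tsum]
      · congr 2
        ext x
        simp [slice]
      · intro i j hij
        exact disjoint_left.2 fun x h1 h2 => disjoint_left.1 (hd hij) h1 h2)

theorem coherentExtension_apply (Λ : Measure T) [SigmaFinite Λ]
    {B : Set (M × T)} (hB : MeasurableSet B) :
    coherentExtension M Λ B = ∫⁻ t, ((slice B t).encard : ℝ≥0∞) ∂Λ :=
  Measure.ofMeasurable_apply B hB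

/-- On the sets `{x} × A`, the transverse invariant measure is `Λ`. -/
theorem coherentExtension_singleton_prod (Λ : Measure T) [SigmaFinite Λ] (x : M) {A : Set T}
    (hA : MeasurableSet A) :
    coherentExtension M Λ {p : M × T | p.1 = x ∧ p.2 ∈ A} = Λ A := by
  rw [coherentExtension_apply Λ
    (show MeasurableSet {p : M × T | p.1 = x ∧ p.2 ∈ A} from
      (measurable_fst (measurableSet_singleton x)).inter (measurable_snd hA)),
    ← lintegral_indicator_one hA]
  refine lintegral_congr fun t => ?_
  by_cases h : t ∈ A <;> simp [slice, h]

theorem snd_eq_of_mem_connectedComponent {M T : Type*} [TopologicalSpace M] [TopologicalSpace T]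
    [DiscreteTopology T] {p q : M × T}
    (h : q ∈ connectedComponent p) : q.2 = p.2 := by
  exact (isPreconnected_connectedComponent.image _ continuous_snd.continuousOn).subsingleton
    (mem_image_of_mem _ h) (mem_image_of_mem _ (mem_connectedComponent (x := p)))

/-- The measure is invariant by measurable holonomy transformations, that is, by measurable
isomorphisms between transversals that map each point to a point in the same leaf. -/
theorem coherentExtension_holonomy [TopologicalSpace T] [DiscreteTopology T] (Λ : Measure T) [SigmaFinite Λ]
    {S S' : Set (M × T)} (hS : IsTransversal S) (hS' : IsTransversal S')
    (γ : S ≃ᵐ S') (hγ : ∀ s : S, (γ s : M × T) ∈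
      connectedComponent (s : M × T)) :
    coherentExtension M Λ S = coherentExtension M Λ S' := by
  rw [coherentExtension_apply Λ hS.1, coherentExtension_apply Λ hS'.1]
  refine lintegral_congr fun t => ?_
  congr 1
  have hγ' : ∀ s : S, (γ s).1.2 = s.1.2 := fun s => snd_eq_of_mem_connectedComponent (hγ s)
  have hγs : ∀ s : S', (γ.symm s).1.2 = s.1.2 := fun s => by
    simpa using (hγ' (γ.symm s)).symm
  let e : slice S t ≃ slice S' t :=
    { toFun := fun x => ⟨(γ ⟨(x.1, t), x.2⟩).1.1, by
        have h1 := hγ' ⟨(x.1, t), x.2⟩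
        have h2 := (γ ⟨(x.1, t), x.2⟩).2
        rw [← Prod.mk.eta (p := (γ ⟨(x.1, t), x.2⟩).1), h1] at h2
        exact h2⟩
      invFun := fun x => ⟨(γ.symm ⟨(x.1, t), x.2⟩).1.1, by
        have h1 := hγs ⟨(x.1, t), x.2⟩
        have h2 := (γ.symm ⟨(x.1, t), x.2⟩).2
        rw [← Prod.mk.eta (p := (γ.symm ⟨(x.1, t), x.2⟩).1), h1] at h2
        exact h2⟩
      left_inv := fun x => by
        have h1 := hγ' ⟨(x.1, t), x.2⟩
        apply Subtype.ext
        have : (⟨((γ ⟨(x.1, t), x.2⟩).1.1, t), by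
            have h2 := (γ ⟨(x.1, t), x.2⟩).2
            rw [← Prod.mk.eta (p := (γ ⟨(x.1, t), x.2⟩).1), h1] at h2
            exact h2⟩ : S') = γ ⟨(x.1, t), x.2⟩ := Subtype.ext (Prod.ext rfl h1.symm)
        simp only [this, MeasurableEquiv.symm_apply_apply]
      right_inv := fun x => by
        have h1 := hγs ⟨(x.1, t), x.2⟩
        apply Subtype.ext
        have : (⟨((γ.symm ⟨(x.1, t), x.2⟩).1.1, t), by
            have h2 := (γ.symm ⟨(x.1, t), x.2⟩).2
            rw [← Prod.mk.eta (p := (γ.symm ⟨(x.1, t), x.2⟩).1), h1] at h2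
            exact h2⟩ : S) = γ.symm ⟨(x.1, t), x.2⟩ := Subtype.ext (Prod.ext rfl h1.symm)
        simp only [this, MeasurableEquiv.apply_symm_apply] }
  exact encard_congr e

/-- The saturation of a null measurable set is null. -/
theorem coherentExtension_saturation [TopologicalSpace T] [DiscreteTopology T] (Λ : Measure T) [SigmaFinite Λ]
    {S : Set (M × T)} (hS : MeasurableSet S) (h : coherentExtension M Λ S = 0) :
    coherentExtension M Λ (⋃ p ∈ S, connectedComponent p) = 0 := by
  rw [coherentExtension_apply Λ hS, lintegral_eq_zero_iff' (aemeasurable_encard_slice Λ hS)] at h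
  obtain ⟨N, hN, hNm, hN0⟩ := exists_measurable_superset_of_null (ae_iff.1 h)
  refine measure_mono_null (t := {p : M × T | p.2 ∈ N}) ?_ ?_
  · refine iUnion₂_subset fun p hp q hq => ?_
    rw [mem_ofPred_eq, snd_eq_of_mem_connectedComponent hq]
    refine hN fun h0 => ?_
    have h0' : slice S p.2 = ∅ := by simpa using h0
    exact (h0' ▸ (show p.1 ∈ slice S p.2 from hp) : p.1 ∈ (∅ : Set M))
  · rw [coherentExtension_apply Λ
      (show MeasurableSet {p : M × T | p.2 ∈ N} from measurable_snd hNm)]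
    refine (lintegral_eq_zero_iff' (aemeasurable_encard_slice Λ
      (show MeasurableSet {p : M × T | p.2 ∈ N} from measurable_snd hNm))).2 ?_
    refine Filter.eventually_of_mem (compl_mem_ae_iff.2 hN0) fun t ht => ?_
    have ht' : t ∉ N := ht
    simp [slice, ht']

end ProductLamination

/-!
The proof compares the two categories one plaque at a time.

For the upper bound, a contraction of an open set `U ⊆ M` to a point `y` gives, by taking the
product with the identity of `T`, a deformation of `U × T` onto a subset of `{y} × T`, which has
measure `Λ(T)` (`tau_prod_univ_le`). A covering of `M` by `k` such sets thus bounds the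
`Λ`-category by `k · Λ(T)`.

For the lower bound, take a countable covering of `M × T` and a deformation of each of its members.
As `T` is discrete, a deformation preserves every plaque `M × {t}`. On a single plaque,
the sets of the covering together move onto at least `Cat(M)` points, counted with multiplicity
(`lsCat_le_tsum_encard_range`): if the final image of a member `V` is finite, then the fibres of the
final map are open in `V`, and the deformation contracts each of them to a point, so `M` is covered
by as many contractible sets as there are final points. Integrating over `t ∈ T` gives
`Cat(M) · Λ(T)` (`lsCat_mul_le_tsum`). Near-optimal deformations then yield the inequality for
the infima. Nothing about manifolds enters beyond the fact that they are Polish.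
-/

/-! ### Contractible sets from finite-valued deformations -/

/-- The Lusternik–Schnirelmann category is at most the total number of points onto which the members
of a countable open covering are deformed. -/
theorem lsCat_le_tsum_encard_range {M : Type*} [TopologicalSpace M] [T1Space M] {ι : Type*}
    [Countable ι] (V : ι → Set M) (hV : ∀ i, IsOpen (V i)) (hcov : ⋃ i, V i = univ)
    (h : ∀ i, V i × ℝ → M) (hc : ∀ i, Continuous (h i)) (h0 : ∀ i x, h i (x, 0) = x) :
    (lsCat M : ℝ≥0∞) ≤ ∑' i, ((range fun x : V i => h i (x, 1)).encard : ℝ≥0∞) := by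
  by_cases hfin : ∀ i, (range fun x : V i => h i (x, 1)).Finite
  swap
  · push Not at hfin
    obtain ⟨i, hi⟩ := hfin
    refine le_trans ?_ (ENNReal.le_tsum i)
    rw [Set.Infinite.encard_eq hi]
    simp
  let S : ι → Set M := fun i => range fun x : V i => h i (x, 1)
  let W : ι → M → Set M := fun i y => Subtype.val '' {x : V i | h i (x, 1) = y}
  have hle : lsCat M ≤ (⋃ i, W i '' S i).encard := by
    refine iInf₂_le_of_le _ ?_ (iInf_le _ ?_)
    · rintro U hU
      obtain ⟨i, y, -, rfl⟩ := mem_iUnion.1 hU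
      constructor
      · refine (hV i).isOpenMap_subtype_val _ ?_
        -- a point of the finite final image is open in it, so the fibre over it is open
        have heq : {x : V i | h i (x, 1) = y} =
            (fun x : V i => h i (x, 1)) ⁻¹' (S i \ {y})ᶜ := by
          ext x
          simp [S]
        rw [heq]
        exact ((hfin i).subset sdiff_subset).isClosed.isOpen_compl.preimage
          ((hc i).comp (by fun_prop))
      · have hmem : ∀ x : W i y, x.1 ∈ V i := by
          rintro ⟨_, x, -, rfl⟩
          exact x.2
        refine ⟨y, ⟨⟨⟨fun p => h i (⟨p.2.1, hmem p.2⟩, p.1.1), ?_⟩, ?_, ?_⟩⟩⟩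
        · exact (hc i).comp (by fun_prop)
        · intro x
          simp [h0]
        · rintro ⟨_, x, hx, rfl⟩
          simpa using hx
    · refine eq_univ_of_forall fun x => ?_
      obtain ⟨i, hi⟩ := mem_iUnion.1 (hcov ▸ mem_univ x)
      exact ⟨W i (h i (⟨x, hi⟩, 1)), mem_iUnion.2 ⟨i, mem_image_of_mem _ ⟨⟨x, hi⟩, rfl⟩⟩,
        ⟨⟨x, hi⟩, rfl, rfl⟩⟩
  calc (lsCat M : ℝ≥0∞) ≤ ((⋃ i, W i '' S i).encard : ℝ≥0∞) := ENat.toENNReal_le.2 hle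
    _ ≤ ∑' i, ((W i '' S i).encard : ℝ≥0∞) := by
      let _ : MeasurableSpace (Set M) := ⊤
      have := measure_iUnion_le (μ := Measure.count) fun i => W i '' S i
      simpa only [Measure.count_apply MeasurableSpace.measurableSet_top] using this
    _ ≤ ∑' i, ((S i).encard : ℝ≥0∞) :=
      ENNReal.tsum_le_tsum fun i => ENat.toENNReal_le.2 (encard_image_le _ _)

namespace ProductLamination

/-! ### The lower bound -/

/-- A deformation of a subset of `M × T` preserves the plaques. -/
theorem snd_deformation {M T : Type*} [TopologicalSpace M] [MeasurableSpace M]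
    [TopologicalSpace T] [DiscreteTopology T] [MeasurableSpace T]
    {U : Set (M × T)} {H : U × ℝ → M × T} (hH : IsDeformation U H)
    (x : U) (s : ℝ) : (H (x, s)).2 = x.1.2 := by
  have hc : Continuous fun s : ℝ => (H (x, s)).2 :=
    continuous_snd.comp (hH.continuous.comp (by fun_prop))
  have := PreconnectedSpace.constant inferInstance hc (x := s) (y := 0)
  simpa [hH.map_zero] using this

/-- On every plaque, the final images of deformed members of a covering have at least `Cat(M)`
points in total. -/
theorem lsCat_le_tsum_encard_slice {M T : Type*} [TopologicalSpace M] [T1Space M]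
    [MeasurableSpace M] [TopologicalSpace T] [DiscreteTopology T] [MeasurableSpace T]
    {ι : Type*} [Countable ι] (U : ι → Set (M × T)) (hU : ∀ i, IsOpen (U i))
    (hcov : ⋃ i, U i = univ) (H : ∀ i, U i × ℝ → M × T)
    (hH : ∀ i, IsDeformation (U i) (H i)) (t : T) :
    (lsCat M : ℝ≥0∞) ≤ ∑' i, ((slice (range fun x : U i => H i (x, 1)) t).encard : ℝ≥0∞) := by
  let h : ∀ i, slice (U i) t × ℝ → M := fun i p => (H i (⟨(p.1.1, t), p.1.2⟩, p.2)).1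
  refine (lsCat_le_tsum_encard_range (fun i => slice (U i) t)
    (fun i => (hU i).preimage (by fun_prop)) ?_ h ?_ ?_).trans ?_
  · refine eq_univ_of_forall fun x => ?_
    obtain ⟨i, hi⟩ := mem_iUnion.1 (hcov ▸ mem_univ (x, t))
    exact mem_iUnion.2 ⟨i, hi⟩
  · intro i
    exact continuous_fst.comp ((hH i).continuous.comp (by fun_prop))
  · intro i x
    simp [h, (hH i).map_zero]
  · refine ENNReal.tsum_le_tsum fun i => ENat.toENNReal_le.2 (encard_le_encard ?_)
    rintro _ ⟨x, rfl⟩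
    exact ⟨⟨(x.1, t), x.2⟩, Prod.ext rfl (snd_deformation (hH i) _ _)⟩

variable {M T : Type*} [TopologicalSpace M] [PolishSpace M] [MeasurableSpace M] [BorelSpace M]
  [TopologicalSpace T] [MeasurableSpace T] [StandardBorelSpace T]

/-- The final images of deformed members of a covering have total measure at least
`Cat(M) · Λ(T)`. -/
theorem lsCat_mul_le_tsum [DiscreteTopology T] (Λ : Measure T) [SigmaFinite Λ] {ι : Type*}
    [Countable ι] (U : ι → Set (M × T)) (hU : ∀ i, IsOpen (U i)) (hcov : ⋃ i, U i = univ)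
    (H : ∀ i, U i × ℝ → M × T) (hH : ∀ i, IsDeformation (U i) (H i)) :
    (lsCat M : ℝ≥0∞) * Λ univ ≤
      ∑' i, coherentExtension M Λ (range fun x : U i => H i (x, 1)) := by
  -- the final images need not be measurable, so measurable hulls are integrated instead
  let B : ι → Set (M × T) := fun i =>
    toMeasurable (coherentExtension M Λ) (range fun x : U i => H i (x, 1))
  have hB : ∀ i, MeasurableSet (B i) := fun i => measurableSet_toMeasurable _ _
  calc (lsCat M : ℝ≥0∞) * Λ univ = ∫⁻ _, (lsCat M : ℝ≥0∞) ∂Λ := (lintegral_const _).symm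
    _ ≤ ∫⁻ t, ∑' i, ((slice (B i) t).encard : ℝ≥0∞) ∂Λ := lintegral_mono fun t =>
      (lsCat_le_tsum_encard_slice U hU hcov H hH t).trans <| ENNReal.tsum_le_tsum fun i =>
        ENat.toENNReal_le.2 <| encard_le_encard fun _ hx => subset_toMeasurable _ _ hx
    _ = ∑' i, ∫⁻ t, ((slice (B i) t).encard : ℝ≥0∞) ∂Λ :=
      lintegral_tsum fun i => aemeasurable_encard_slice Λ (hB i)
    _ = ∑' i, coherentExtension M Λ (range fun x : U i => H i (x, 1)) := by
      refine tsum_congr fun i => ?_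
      rw [← coherentExtension_apply Λ (hB i), measure_toMeasurable]

theorem lsCat_mul_le_lambdaCat [DiscreteTopology T] (Λ : Measure T) [SigmaFinite Λ] :
    (lsCat M : ℝ≥0∞) * Λ univ ≤ lambdaCat (coherentExtension M Λ) := by
  refine le_iInf₂ fun 𝒰 h𝒰 => le_iInf₂ fun hU hcov => ?_
  have : Countable 𝒰 := h𝒰.to_subtype
  refine ENNReal.le_of_forall_pos_le_add fun ε hε hfin => ?_
  obtain ⟨δ, δpos, hδ⟩ := ENNReal.exists_pos_sum_of_countable' (ENNReal.coe_pos.2 hε).ne' 𝒰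
  have hex : ∀ U : 𝒰, ∃ H : U.1 × ℝ → M × T, IsDeformation U.1 H ∧
      coherentExtension M Λ (range fun x : U.1 => H (x, 1)) <
        tau (coherentExtension M Λ) U.1 + δ U := by
    intro U
    have hlt : tau (coherentExtension M Λ) U.1 < tau (coherentExtension M Λ) U.1 + δ U :=
      ENNReal.lt_add_right (ENNReal.ne_top_of_tsum_ne_top hfin.ne U) (δpos U).ne'
    conv_lhs at hlt => rw [tau]
    simpa only [iInf_lt_iff, exists_prop] using hlt
  choose H hH hlt using hex
  calc (lsCat M : ℝ≥0∞) * Λ univ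
      ≤ ∑' U : 𝒰, coherentExtension M Λ (range fun x : U.1 => H U (x, 1)) :=
        lsCat_mul_le_tsum Λ (fun U : 𝒰 => U.1) (fun U => (hU U U.2).1)
          (by rw [← sUnion_eq_iUnion, hcov]) H hH
    _ ≤ ∑' U : 𝒰, (tau (coherentExtension M Λ) U.1 + δ U) :=
        ENNReal.tsum_le_tsum fun U => (hlt U).le
    _ = ∑' U : 𝒰, tau (coherentExtension M Λ) U.1 + ∑' U, δ U := ENNReal.tsum_add
    _ ≤ _ := by gcongr

/-! ### The upper bound -/

/-- If `U` is contractible within `M`, then `U × T` is deformed into a copy of `T`. -/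
theorem tau_prod_univ_le (Λ : Measure T) [SigmaFinite Λ] {U : Set M}
    (hU : (ContinuousMap.mk (Subtype.val : U → M) continuous_subtype_val).Nullhomotopic) :
    tau (coherentExtension M Λ) (U ×ˢ (univ : Set T)) ≤ Λ univ := by
  obtain ⟨y, ⟨F⟩⟩ := hU
  -- the homotopy is extended to the real line by clamping the time to `[0, 1]`
  let G : U × ℝ → M := fun p => F (projIcc 0 1 zero_le_one p.2, p.1)
  have hG : Continuous G := F.continuous.comp (by fun_prop)
  let ρ : ↥(U ×ˢ (univ : Set T)) → U := fun p => ⟨p.1.1, p.2.1⟩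
  have hρ : Continuous ρ := by fun_prop
  have hρm : Measurable ρ := by fun_prop
  have hdef : IsDeformation (U ×ˢ (univ : Set T)) fun p => (G (ρ p.1, p.2), p.1.1.2) :=
    { continuous := by fun_prop
      measurable := by
        have := hG.measurable
        fun_prop
      map_zero := fun x => by simp [G, ρ] }
  calc tau (coherentExtension M Λ) (U ×ˢ (univ : Set T))
      ≤ coherentExtension M Λ _ := iInf₂_le _ hdef
    _ ≤ coherentExtension M Λ {p : M × T | p.1 = y ∧ p.2 ∈ univ} := by
      refine measure_mono ?_
      rintro _ ⟨x, rfl⟩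
      simp [G]
    _ = Λ univ := coherentExtension_singleton_prod Λ y .univ

theorem lambdaCat_le_encard_mul (Λ : Measure T) [SigmaFinite Λ] {𝒱 : Set (Set M)}
    (hfin : 𝒱.Finite) (hV : ∀ U ∈ 𝒱, IsOpen U ∧
      (ContinuousMap.mk (Subtype.val : U → M) continuous_subtype_val).Nullhomotopic)
    (hcov : ⋃₀ 𝒱 = univ) :
    lambdaCat (coherentExtension M Λ) ≤ (𝒱.encard : ℝ≥0∞) * Λ univ := by
  let P : Set (Set (M × T)) := (fun U : Set M => U ×ˢ (univ : Set T)) '' 𝒱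
  calc lambdaCat (coherentExtension M Λ)
      ≤ ∑' W : P, tau (coherentExtension M Λ) W.1 := by
        refine iInf₂_le_of_le P (hfin.image _).countable (iInf₂_le ?_ ?_)
        · rintro _ ⟨U, hU, rfl⟩
          exact ⟨(hV U hU).1.prod isOpen_univ, (hV U hU).1.measurableSet.prod .univ⟩
        · refine eq_univ_of_forall fun p => ?_
          obtain ⟨U, hU, hp⟩ := mem_sUnion.1 (hcov ▸ mem_univ p.1)
          exact ⟨_, mem_image_of_mem _ hU, hp, mem_univ _⟩
    _ ≤ ∑' _ : P, Λ univ := by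
        refine ENNReal.tsum_le_tsum ?_
        rintro ⟨_, U, hU, rfl⟩
        exact tau_prod_univ_le Λ (hV U hU).2
    _ = (P.encard : ℝ≥0∞) * Λ univ := ENNReal.tsum_const _
    _ ≤ (𝒱.encard : ℝ≥0∞) * Λ univ := by
        gcongr
        exact encard_image_le _ _

theorem lambdaCat_eq_zero (Λ : Measure T) [SigmaFinite Λ] (h : Λ univ = 0) :
    lambdaCat (coherentExtension M Λ) = 0 := by
  have hν : coherentExtension M Λ univ = 0 := by
    rw [coherentExtension_apply Λ .univ, Measure.measure_univ_eq_zero.1 h, lintegral_zero_measure]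
  refine le_antisymm ?_ zero_le
  calc lambdaCat (coherentExtension M Λ)
      ≤ ∑' W : ({univ} : Set (Set (M × T))), tau (coherentExtension M Λ) W.1 :=
        iInf₂_le_of_le _ (countable_singleton _) (iInf₂_le (by simp) (by simp))
    _ = tau (coherentExtension M Λ) univ := tsum_singleton univ (tau (coherentExtension M Λ))
    _ ≤ coherentExtension M Λ _ :=
        iInf₂_le (fun p => p.1.1) ⟨by fun_prop, by fun_prop, fun _ => rfl⟩
    _ ≤ 0 := (measure_mono (subset_univ _)).trans hν.le

theorem lambdaCat_le_lsCat_mul (Λ : Measure T) [SigmaFinite Λ] :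
    lambdaCat (coherentExtension M Λ) ≤ (lsCat M : ℝ≥0∞) * Λ univ := by
  obtain h | h := eq_or_ne (Λ univ) 0
  · simp [lambdaCat_eq_zero Λ h]
  obtain hM | hM := eq_or_ne (lsCat M) ⊤
  · simp [hM, ENNReal.top_mul h]
  -- a finite category is attained, as `ℕ∞` is well-ordered
  obtain ⟨𝒱, hlt⟩ := iInf_lt_iff.1 (ENat.lt_add_one_iff hM |>.2 (le_refl (lsCat M)))
  obtain ⟨hV, hlt⟩ := iInf_lt_iff.1 hlt
  obtain ⟨hcov, hlt⟩ := iInf_lt_iff.1 hlt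
  have hle : 𝒱.encard ≤ lsCat M := (ENat.lt_add_one_iff hM).1 hlt
  have hfin : 𝒱.Finite := encard_ne_top_iff.1 (ne_top_of_le_ne_top hM hle)
  refine (lambdaCat_le_encard_mul Λ hfin hV hcov).trans ?_
  gcongr

end ProductLamination

/-- For a topological manifold `M` (Hausdorff and second countable, that is, Polish) and a standard
Borel space `T`, considered with the discrete topology,
and a σ-finite measure `Λ` on `T`, the `Λ`-category of the product lamination `M × T` is
`Cat(M) · Λ(T)`. -/
theorem propositionp (n : ℕ) {M : Type*} [TopologicalSpace M] [PolishSpace M]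
    [ChartedSpace (EuclideanSpace ℝ (Fin n)) M] [MeasurableSpace M] [BorelSpace M]
    {T : Type*} [TopologicalSpace T] [DiscreteTopology T] [MeasurableSpace T]
    [StandardBorelSpace T] (Λ : Measure T) [SigmaFinite Λ] :
    lambdaCat (ProductLamination.coherentExtension M Λ) = (lsCat M : ℝ≥0∞) * Λ univ :=
  le_antisymm (ProductLamination.lambdaCat_le_lsCat_mul Λ)
    (ProductLamination.lsCat_mul_le_lambdaCat Λ)
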